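/- Let $V\hookrightarrow H=H'\hookrightarrow V'$ be a Gelfand triple of complex Hilbert spaces (continuous dense embeddings; $\|\cdot\|$ and $\|\cdot\|_V$ are the norms of $H$ and $V$; $V'$ is the space of bounded antilinear functionals on $V$, with pairing $\langle\cdot,\cdot\rangle$). Let $k\in\{1,\dots,6\}$, let $\omega_0,\dots,\omega_k$ be the coefficients of the $k$-step BDF method, $\sum_{j=0}^k\omega_j\zeta^j=\sum_{\ell=1}^k\frac1\ell(1-\zeta)^\ell$, and let $\beta_0>0$ and $\tau_0>0$. Then there are constants $c,c_1>0$, depending only on the triple, $k$, $\beta_0$ and $\tau_0$, such that the following holds for every $T>0$. There exist $\kappa>0$ with $c\kappa e^{-c_1T}<\frac12$, and for every such $\kappa$ one has $$\gamma(\kappa):=\frac{c\,\kappa\, e^{-c_1T}}{1-c\,\kappa\, e^{-c_1T}}\in(0,1)$$ and the following contraction estimate. Let $A:V\to V'$ be any bounded linear self-adjoint operator with $\beta_0\|u\|_V^2\le\langle Au,u\rangle\le\beta_1\|u\|_V^2$ for all $u\in V$, for some $\beta_1>\beta_0$. Let $N\ge1$ be any integer such that $\tau=T/N\le\tau_0$,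 and let $m\ge1$. If, for given $U_{m-1}^{n}\in H$ ($N-k+1\le n\le N$), the vectors $U_m^n\in V$ ($1\le n\le N$) and $U_m^{-j}\in H$ ($0\le j\le k-1$) solve the step of the homogeneous parallel BDF$k$ iteration $$\frac1\tau\sum_{j=0}^k\omega_jU_m^{n-j}+AU_m^n=0\ \text{ in } V'\quad(1\le n\le N),\qquad U_m^{-j}=\kappa\,(U_m^{N-j}-U_{m-1}^{N-j})\quad(0\le j\le k-1),$$ then $$\sum_{j=0}^{k-1}\|U_m^{N-j}\|\le\gamma(\kappa)\sum_{j=0}^{k-1}\|U_{m-1}^{N-j}\|.$$ In particular $\kappa$ and $\gamma(\kappa)$ are independent of $\tau$. (For a fixed $T$, the choice $\tau_0=T$ admits all step sizes $\tau=T/N$.) -/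

import Mathlib

noncomputable section

namespace ParallelBDF

/-- The generating polynomial `δ_k(ζ) = ∑_{ℓ=1}^k (1/ℓ) (1-ζ)^ℓ` of the `k`-step BDF method. -/
def bdfPoly (k : ℕ) : Polynomial ℝ :=
  ∑ l ∈ Finset.Icc 1 k, Polynomial.C (1 / (l : ℝ)) * (1 - Polynomial.X) ^ l

/-- The BDF coefficients `ω_0, …, ω_k`, defined by `δ_k(ζ) = ∑_j ω_j ζ^j`. -/
def bdfCoeff (k j : ℕ) : ℝ := (bdfPoly k).coeff j

/-- The factor `γ(κ) = c κ e^{-c₁ T} / (1 - c κ e^{-c₁ T})`. -/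
def gammaFactor (c c₁ T κ : ℝ) : ℝ :=
  c * κ * Real.exp (-c₁ * T) / (1 - c * κ * Real.exp (-c₁ * T))

variable {V H : Type*}
  [NormedAddCommGroup V] [InnerProductSpace ℂ V]
  [NormedAddCommGroup H] [InnerProductSpace ℂ H]

/-- `V` is continuously and densely embedded in `H` through `ι`. The dual `V'` is the space
`V →L⋆[ℂ] ℂ` of bounded antilinear functionals on `V`, so that the pairing of `V'` with `V` is
linear in the first and antilinear in the second argument, like the inner product `(u, v)`. -/
structure IsGelfandEmbedding (ι : V →L[ℂ] H) : Prop where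
  injective : Function.Injective ι
  denseRange : DenseRange ι

/-- The embedding `H ↪ V'`, `⟨h, φ⟩ = (h, φ)` for `φ ∈ V ⊂ H`. Mathlib's `inner ℂ x y` is
antilinear in `x` and linear in `y`, so that `(h, φ)` is `inner ℂ (ι φ) h`. -/
def toAntidual (ι : V →L[ℂ] H) (h : H) : V →L⋆[ℂ] ℂ :=
  (innerSLFlip ℂ h).comp ι

@[simp]
theorem toAntidual_apply (ι : V →L[ℂ] H) (h : H) (φ : V) :
    toAntidual ι h φ = inner ℂ (ι φ) h := rfl

/-- `A : V → V'` is self-adjoint and `β₀ ‖u‖_V² ≤ ⟨A u, u⟩ ≤ β₁ ‖u‖_V²` (the number `⟨A u, u⟩`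
is real, by self-adjointness). Boundedness and linearity are part of the type of `A`. -/
structure IsEllipticSelfAdjoint (A : V →L[ℂ] (V →L⋆[ℂ] ℂ)) (β₀ β₁ : ℝ) : Prop where
  selfAdjoint : ∀ u w : V, A u w = star (A w u)
  lower : ∀ u : V, β₀ * ‖u‖ ^ 2 ≤ (A u u).re
  upper : ∀ u : V, (A u u).re ≤ β₁ * ‖u‖ ^ 2

/-- The BDF difference quotient `(1/τ) ∑_{j=0}^k ω_j U^{n-j}`. -/
def bdfDiff (k : ℕ) (τ : ℝ) (U : ℤ → H) (n : ℤ) : H :=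
  ((τ⁻¹ : ℝ) : ℂ) • ∑ j ∈ Finset.range (k + 1), ((bdfCoeff k j : ℝ) : ℂ) • U (n - (j : ℤ))

/-- One step of the parallel-in-time BDF`k` iteration with `N` time steps of size `τ`, relaxation
parameter `κ`, initial value `v` and right-hand side `F n ∈ V'`: from the previous iterate `Uprev`
(of which only the entries `N-k+1, …, N` are used) to the new iterate `U`, whose entries are
`U^{-(k-1)}, …, U^0 ∈ H` and `U^1, …, U^N ∈ V`:
* `(1/τ) ∑_{j=0}^k ω_j U^{n-j} + A U^n = F n` in `V'`, for `1 ≤ n ≤ N`;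
* `U^{-j} = v + κ (U^{N-j} - Uprev^{N-j})` for `0 ≤ j ≤ k-1`.
The values of `U` and `Uprev` at other indices play no role. -/
structure IsIterationStep (ι : V →L[ℂ] H) (A : V →L[ℂ] (V →L⋆[ℂ] ℂ)) (k N : ℕ) (τ κ : ℝ)
    (v : H) (F : ℤ → (V →L⋆[ℂ] ℂ)) (Uprev U : ℤ → H) : Prop where
  equation : ∀ n : ℤ, 1 ≤ n → n ≤ (N : ℤ) →
    ∃ w : V, ι w = U n ∧ toAntidual ι (bdfDiff k τ U n) + A w = F n
  start : ∀ j : ℕ, j < k →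
    U (-(j : ℤ)) = v + (κ : ℂ) • (U ((N : ℤ) - j) - Uprev ((N : ℤ) - j))

end ParallelBDF

end

/-! Let `q = c κ e^{-c₁T}`. If the homogeneous scheme damps its starting values by `c e^{-c₁T}` over
time `T`, the final block of the new iterate has size `E ≤ q (E + E')`, with `E'` that of the old
iterate, because the starting values are `κ` times a difference of final values. Hence `E ≤ q/(1-q)
E'`, and `q < 1/2` makes the factor less than one.

The work lies in a decay rate uniform in `τ` and `A` (`exists_exponential_stability`). Orders `k ≥
3` are not A-stable, so testing with `U^n` alone gives no energy. The scheme is tested instead with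
a fixed combination `∑ m_j U^{n-j}`. Rational matrices `G` and `P` bound the two resulting products
below by differences of quadratic forms on six-step windows, plus `ε ∑ ‖U^{n-j}‖_A²`. Ellipticity
lets this surplus control the energy, which therefore decays geometrically (`exists_decay`).

The energy contains `τ ‖·‖_A²`, while the starting values lie only in `H`. It is therefore launched
from `U^1, …, U^6`, which `step_bound` controls one implicit step at a time. -/

namespace ParallelBDF

/-! ### From scalar quadratic inequalities to semidefinite forms -/

section BilinearForms

variable {E : Type*} [AddCommGroup E] [Module ℝ E]

open scoped MatrixOrder in
/-- The Gram matrix of a positive semidefinite form is a sum of rank-one squares. -/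
theorem exists_gram_factor {n : ℕ} (B : E →ₗ[ℝ] E →ₗ[ℝ] ℝ) (hsymm : ∀ x y, B x y = B y x)
    (hnonneg : ∀ x, 0 ≤ B x x) (x : Fin n → E) :
    ∃ C : Matrix (Fin n) (Fin n) ℝ, ∀ i j, B (x i) (x j) = ∑ l, C l i * C l j := by
  have hpsd : (Matrix.of fun i j => B (x i) (x j)).PosSemidef := by
    refine Matrix.PosSemidef.of_dotProduct_mulVec_nonneg ?_ fun c => ?_
    · ext i j
      simp [hsymm (x i) (x j)]
    · have h := hnonneg (∑ i, c i • x i)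
      simp only [map_sum, map_smul, LinearMap.sum_apply, LinearMap.smul_apply, smul_eq_mul] at h
      simpa [dotProduct, Matrix.mulVec, Finset.mul_sum, mul_comm, mul_left_comm,
        hsymm] using h
  obtain ⟨C, hC⟩ := (CStarAlgebra.nonneg_iff_eq_star_mul_self.mp hpsd.nonneg)
  refine ⟨C, fun i j => ?_⟩
  have := congrFun (congrFun hC i) j
  simpa [Matrix.mul_apply] using this

/-- A linear functional that is nonnegative on rank-one squares is nonnegative on Gram matrices. -/
theorem nonneg_on_gram {n : ℕ} (B : E →ₗ[ℝ] E →ₗ[ℝ] ℝ) (hsymm : ∀ x y, B x y = B y x)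
    (hnonneg : ∀ x, 0 ≤ B x x) (L : Matrix (Fin n) (Fin n) ℝ →ₗ[ℝ] ℝ)
    (hL : ∀ c : Fin n → ℝ, 0 ≤ L (Matrix.of fun i j => c i * c j)) (x : Fin n → E) :
    0 ≤ L (Matrix.of fun i j => B (x i) (x j)) := by
  obtain ⟨C, hC⟩ := exists_gram_factor B hsymm hnonneg x
  have : (Matrix.of fun i j => B (x i) (x j)) = ∑ l, Matrix.of fun i j => C l i * C l j := by
    ext i j
    simp [hC, Matrix.sum_apply]
  rw [this, map_sum]
  exact Finset.sum_nonneg fun l _ => hL (C l)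

/-- The quadratic form `∑ M i j B(y i, y j)` on tuples of vectors. -/
def tupleForm {n : ℕ} (M : Matrix (Fin n) (Fin n) ℝ) (B : E →ₗ[ℝ] E →ₗ[ℝ] ℝ)
    (y : Fin n → E) : ℝ :=
  ∑ i, ∑ j, M i j * B (y i) (y j)

theorem tupleForm_le {n : ℕ} (M : Matrix (Fin n) (Fin n) ℝ) (B : E →ₗ[ℝ] E →ₗ[ℝ] ℝ)
    (hsymm : ∀ x y, B x y = B y x) (hnonneg : ∀ x, 0 ≤ B x x) (y : Fin n → E) :
    tupleForm M B y ≤ (∑ i, ∑ j, |M i j|) * ∑ i, B (y i) (y i) := by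
  have hle : ∀ i, B (y i) (y i) ≤ ∑ i, B (y i) (y i) := fun i =>
    Finset.single_le_sum (f := fun i => B (y i) (y i)) (fun j _ => hnonneg _) (Finset.mem_univ i)
  rw [tupleForm, Finset.sum_mul]
  refine Finset.sum_le_sum fun i _ => ?_
  rw [Finset.sum_mul]
  refine Finset.sum_le_sum fun j _ => ?_
  -- Nonnegativity at `y i ± y j` gives `2 |B (y i) (y j)| ≤ B (y i) (y i) + B (y j) (y j)`.
  have h1 := hnonneg (y i + y j)
  have h2 := hnonneg (y i - y j)
  simp only [map_add, map_sub, LinearMap.add_apply, LinearMap.sub_apply, hsymm (y j) (y i)]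
    at h1 h2
  calc M i j * B (y i) (y j) ≤ |M i j| * |B (y i) (y j)| := by
        rw [← abs_mul]; exact le_abs_self _
    _ ≤ _ := by
        refine mul_le_mul_of_nonneg_left ?_ (abs_nonneg _)
        rw [abs_le]
        constructor <;> linarith [hle i, hle j]

end BilinearForms

/-! ### Lyapunov certificates and the energy inequality -/

/-- Data for a quadratic Lyapunov function of the multistep scheme with coefficients `w`, obtained
with the multiplier `m`. -/
structure IsLyapunovPair (w m : Fin 7 → ℝ) (G P : Matrix (Fin 6) (Fin 6) ℝ) (ε : ℝ) : Prop where
  pos : 0 < ε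
  lower : ∀ x : Fin 6 → ℝ, ε * (x 0 * x 0) ≤ ∑ i, ∑ j, G i j * (x i * x j)
  nonneg : ∀ x : Fin 6 → ℝ, 0 ≤ ∑ i, ∑ j, P i j * (x i * x j)
  dissipation : ∀ x : Fin 7 → ℝ,
    ∑ i, ∑ j, G i j * (x i.castSucc * x j.castSucc) - ∑ i, ∑ j, G i j * (x i.succ * x j.succ) ≤
      ∑ i, ∑ j, w i * m j * (x i * x j)
  coercive : ∀ x : Fin 7 → ℝ,
    ∑ i, ∑ j, P i j * (x i.castSucc * x j.castSucc) - ∑ i, ∑ j, P i j * (x i.succ * x j.succ) +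
      ε * ∑ i, x i * x i ≤ ∑ j, m j * (x 0 * x j)

namespace IsLyapunovPair

variable {E : Type*} [AddCommGroup E] [Module ℝ E] {w m : Fin 7 → ℝ}
  {G P : Matrix (Fin 6) (Fin 6) ℝ} {ε : ℝ} {a b : E →ₗ[ℝ] E →ₗ[ℝ] ℝ}

local notation "entry" => Matrix.entryLinearMap ℝ ℝ

theorem le_tupleForm (h : IsLyapunovPair w m G P ε) (hb : ∀ x y, b x y = b y x)
    (hb0 : ∀ x, 0 ≤ b x x) (y : Fin 6 → E) : ε * b (y 0) (y 0) ≤ tupleForm G b y := by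
  have := nonneg_on_gram b hb hb0
    (∑ i, ∑ j, G i j • entry i j - ε • entry (0 : Fin 6) (0 : Fin 6))
    (fun c => by simpa [LinearMap.sum_apply] using h.lower c) y
  simpa [LinearMap.sum_apply, tupleForm] using this

theorem tupleForm_nonneg (h : IsLyapunovPair w m G P ε) (ha : ∀ x y, a x y = a y x)
    (ha0 : ∀ x, 0 ≤ a x x) (y : Fin 6 → E) : 0 ≤ tupleForm P a y := by
  have := nonneg_on_gram a ha ha0 (∑ i, ∑ j, P i j • entry i j)
    (fun c => by simpa [LinearMap.sum_apply] using h.nonneg c) y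
  simpa [LinearMap.sum_apply, tupleForm] using this

/-- The energy inequality: testing one step of the scheme with `∑ m j • x j`. -/
theorem energy_le (h : IsLyapunovPair w m G P ε) (ha : ∀ x y, a x y = a y x)
    (ha0 : ∀ x, 0 ≤ a x x) (hb : ∀ x y, b x y = b y x) (hb0 : ∀ x, 0 ≤ b x x) {τ : ℝ}
    (hτ : 0 ≤ τ) (x : Fin 7 → E)
    (heq : ∀ φ, ∑ i, w i * b (x i) φ + τ * a (x 0) φ = 0) :
    tupleForm G b (fun i => x i.castSucc) + τ * tupleForm P a (fun i => x i.castSucc) +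
      τ * (ε * ∑ i, a (x i) (x i)) ≤
    tupleForm G b (fun i => x i.succ) + τ * tupleForm P a (fun i => x i.succ) := by
  have h1 := nonneg_on_gram b hb hb0
    (∑ i, ∑ j, (w i * m j) • entry i j -
      (∑ i : Fin 6, ∑ j : Fin 6, G i j • entry i.castSucc j.castSucc -
        ∑ i : Fin 6, ∑ j : Fin 6, G i j • entry i.succ j.succ))
    (fun c => by simpa [LinearMap.sum_apply] using h.dissipation c) x
  have h2 := nonneg_on_gram a ha ha0
    (∑ j, m j • entry (0 : Fin 7) j -
      (∑ i : Fin 6, ∑ j : Fin 6, P i j • entry i.castSucc j.castSucc -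
        ∑ i : Fin 6, ∑ j : Fin 6, P i j • entry i.succ j.succ + ε • ∑ i : Fin 7, entry i i))
    (fun c => by simpa [LinearMap.sum_apply] using h.coercive c) x
  have h3 := heq (∑ j, m j • x j)
  simp only [LinearMap.sub_apply, LinearMap.add_apply, LinearMap.sum_apply, LinearMap.smul_apply,
    Matrix.entryLinearMap_apply, Matrix.of_apply, smul_eq_mul] at h1 h2
  simp only [map_sum, map_smul, smul_eq_mul, Finset.mul_sum, ← mul_assoc] at h3
  have h4 := mul_nonneg hτ h2
  simp only [tupleForm]
  simp only [mul_sub, mul_add, Finset.mul_sum, ← mul_assoc] at h1 h3 h4 ⊢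
  linarith

end IsLyapunovPair

/-! ### BDF coefficients -/

theorem bdfCoeff_eq_sum (k j : ℕ) :
    bdfCoeff k j = ∑ l ∈ Finset.Icc 1 k, 1 / (l : ℝ) * ((-1) ^ j * (l.choose j : ℝ)) := by
  have hcoeff : ∀ l : ℕ, ((1 - Polynomial.X : Polynomial ℝ) ^ l).coeff j =
      (-1) ^ j * (l.choose j : ℝ) := by
    intro l
    have h : (1 - Polynomial.X : Polynomial ℝ) ^ l =
        ((1 + Polynomial.X) ^ l).comp (Polynomial.C (-1) * Polynomial.X) := by
      simp [sub_eq_add_neg]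
    rw [h, Polynomial.comp_C_mul_X_coeff, Polynomial.coeff_one_add_X_pow, mul_comm]
  simp only [bdfCoeff, bdfPoly, Polynomial.finsetSum_coeff, Polynomial.coeff_C_mul, hcoeff]

theorem bdfCoeff_eq_zero {k j : ℕ} (h : k < j) : bdfCoeff k j = 0 := by
  rw [bdfCoeff_eq_sum]
  refine Finset.sum_eq_zero fun l hl => ?_
  rw [Nat.choose_eq_zero_of_lt (by have := (Finset.mem_Icc.mp hl).2; omega)]
  simp

theorem bdfCoeff_zero_pos {k : ℕ} (hk : 1 ≤ k) : 0 < bdfCoeff k 0 := by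
  rw [bdfCoeff_eq_sum]
  refine Finset.sum_pos (fun l hl => ?_) ⟨1, by simp [hk]⟩
  have : 0 < (l : ℝ) := by exact_mod_cast (Finset.mem_Icc.mp hl).1
  simp only [pow_zero, Nat.choose_zero_right, Nat.cast_one, mul_one]
  positivity

/-! ### Explicit certificates for orders one to six -/

/-- The coefficients of the multiplier `1 - (7/5) ζ + (7/10) ζ² - (3/20) ζ³`, which serves all BDF
methods of order at most six. -/
noncomputable def multiplier : Fin 7 → ℝ := ![1, -7/5, 7/10, -3/20, 0, 0, 0]

/-- The storage matrix of the multiplier. -/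
noncomputable def multiplierMatrix : Matrix (Fin 6) (Fin 6) ℝ :=
  !![91/100, -11/20, 1/5, 0, 0, 0;
      -11/20, 17/30, -13/60, 0, 0, 0;
      1/5, -13/60, 31/150, 0, 0, 0;
      0, 0, 0, 3/100, 0, 0;
      0, 0, 0, 0, 1/50, 0;
      0, 0, 0, 0, 0, 1/100]

theorem multiplierMatrix_nonneg (x : Fin 6 → ℝ) :
    0 ≤ ∑ i, ∑ j, multiplierMatrix i j * (x i * x j) := by
  simp only [multiplierMatrix, Fin.sum_univ_six, Matrix.of_apply, Matrix.cons_val]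
  linarith [sq_nonneg (12 * x 0 - 13 * x 1 + 10 * x 2),
    sq_nonneg (-58 * x 0 + 47 * x 1),
    sq_nonneg (x 0),
    sq_nonneg (x 1), sq_nonneg (x 2), sq_nonneg (x 3), sq_nonneg (x 4), sq_nonneg (x 5)]

/-- The diagonal tail `3/100, 2/100, 1/100` telescopes and supplies exactly the terms `x i ^ 2 /
100` for `i = 4, 5, 6`, where the multiplier vanishes. The remaining slack is a form in `x 0, …, x
3` only, a positive combination of the listed squares. -/
theorem multiplierMatrix_coercive (x : Fin 7 → ℝ) :
    ∑ i, ∑ j, multiplierMatrix i j * (x i.castSucc * x j.castSucc) -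
      ∑ i, ∑ j, multiplierMatrix i j * (x i.succ * x j.succ) + 1 / 100 * ∑ i, x i * x i ≤
      ∑ j, multiplier j * (x 0 * x j) := by
  simp only [multiplierMatrix, multiplier, Fin.sum_univ_six, Fin.sum_univ_seven, Matrix.of_apply,
    Matrix.cons_val, Fin.reduceCastSucc, Fin.reduceSucc]
  linarith [sq_nonneg (-9 * x 0 + 24 * x 1 - 26 * x 2 + 20 * x 3),
    sq_nonneg (63 * x 0 - 88 * x 1 + 82 * x 2),
    sq_nonneg (-x 0 + 4 * x 1),
    sq_nonneg (x 0)]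

/-- As in all six cases, only `G` depends on the order. The squares come from triangular
elimination, with weights left to `linarith`. In the dissipation inequality they involve only
differences: the BDF coefficients sum to zero, so the slack vanishes on constant vectors, and a
semidefinite form then depends on consecutive differences alone. -/
theorem isLyapunovPair_bdf_one : ∃ G,
    IsLyapunovPair (fun i => bdfCoeff 1 i) multiplier G multiplierMatrix (1 / 100) := by
  have hw : (fun i : Fin 7 => bdfCoeff 1 i) = ![1, -1, 0, 0, 0, 0, 0] := by
    ext i
    fin_cases i <;> norm_num [bdfCoeff_eq_sum, Finset.sum_Icc_succ_top, Nat.choose]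
  rw [hw]
  refine ⟨!![31/40, -9/10, 1/5, 0, 0, 0;
      -9/10, 3/2, -3/5, 0, 0, 0;
      1/5, -3/5, 2/5, 0, 0, 0;
      0, 0, 0, 0, 0, 0;
      0, 0, 0, 0, 0, 0;
      0, 0, 0, 0, 0, 0],
    by norm_num, fun x => ?_, multiplierMatrix_nonneg, fun x => ?_, multiplierMatrix_coercive⟩
  · simp only [Fin.sum_univ_six, Matrix.of_apply, Matrix.cons_val]
    linarith [sq_nonneg (x 0 - 3 * x 1 + 2 * x 2),
    sq_nonneg (-x 0 + x 1),
    sq_nonneg (x 0)]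
  · simp only [multiplier, Fin.sum_univ_six, Fin.sum_univ_seven, Matrix.of_apply,
      Matrix.cons_val, Fin.reduceCastSucc, Fin.reduceSucc]
    linarith [sq_nonneg (3 * (x 0 - x 1) - 8 * (x 1 - x 2) + 16 * (x 2 - x 3)),
    sq_nonneg (-3 * (x 0 - x 1) + 16 * (x 1 - x 2)),
    sq_nonneg ((x 0 - x 1))]

theorem isLyapunovPair_bdf_two : ∃ G,
    IsLyapunovPair (fun i => bdfCoeff 2 i) multiplier G multiplierMatrix (1 / 100) := by
  have hw : (fun i : Fin 7 => bdfCoeff 2 i) = ![3/2, -2, 1/2, 0, 0, 0, 0] := by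
    ext i
    fin_cases i <;> norm_num [bdfCoeff_eq_sum, Finset.sum_Icc_succ_top, Nat.choose]
  rw [hw]
  refine ⟨!![97/80, -3/2, 2/5, 0, 0, 0;
      -3/2, 41/16, -11/10, 0, 0, 0;
      2/5, -11/10, 7/10, 0, 0, 0;
      0, 0, 0, 0, 0, 0;
      0, 0, 0, 0, 0, 0;
      0, 0, 0, 0, 0, 0],
    by norm_num, fun x => ?_, multiplierMatrix_nonneg, fun x => ?_, multiplierMatrix_coercive⟩
  · simp only [Fin.sum_univ_six, Matrix.of_apply, Matrix.cons_val]
    linarith [sq_nonneg (4 * x 0 - 11 * x 1 + 7 * x 2),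
    sq_nonneg (-488 * x 0 + 467 * x 1),
    sq_nonneg (x 0)]
  · simp only [multiplier, Fin.sum_univ_six, Fin.sum_univ_seven, Matrix.of_apply,
      Matrix.cons_val, Fin.reduceCastSucc, Fin.reduceSucc]
    linarith [sq_nonneg (9 * (x 0 - x 1) - 35 * (x 1 - x 2) + 56 * (x 2 - x 3)),
    sq_nonneg (-123 * (x 0 - x 1) + 233 * (x 1 - x 2)),
    sq_nonneg ((x 0 - x 1))]

theorem isLyapunovPair_bdf_three : ∃ G,
    IsLyapunovPair (fun i => bdfCoeff 3 i) multiplier G multiplierMatrix (1 / 100) := by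
  have hw : (fun i : Fin 7 => bdfCoeff 3 i) = ![11/6, -3, 3/2, -1/3, 0, 0, 0] := by
    ext i
    fin_cases i <;> norm_num [bdfCoeff_eq_sum, Finset.sum_Icc_succ_top, Nat.choose]
  rw [hw]
  refine ⟨!![23/16, -19/10, 3/5, 0, 0, 0;
      -19/10, 257/80, -7/5, 0, 0, 0;
      3/5, -7/5, 33/40, 0, 0, 0;
      0, 0, 0, 0, 0, 0;
      0, 0, 0, 0, 0, 0;
      0, 0, 0, 0, 0, 0],
    by norm_num, fun x => ?_, multiplierMatrix_nonneg, fun x => ?_, multiplierMatrix_coercive⟩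
  · simp only [Fin.sum_univ_six, Matrix.of_apply, Matrix.cons_val]
    linarith [sq_nonneg (24 * x 0 - 56 * x 1 + 33 * x 2),
    sq_nonneg (-2328 * x 0 + 2209 * x 1),
    sq_nonneg (x 0)]
  · simp only [multiplier, Fin.sum_univ_six, Fin.sum_univ_seven, Matrix.of_apply,
      Matrix.cons_val, Fin.reduceCastSucc, Fin.reduceSucc]
    linarith [sq_nonneg (73 * (x 0 - x 1) - 181 * (x 1 - x 2) + 210 * (x 2 - x 3)),
    sq_nonneg (-11357 * (x 0 - x 1) + 20369 * (x 1 - x 2)),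
    sq_nonneg ((x 0 - x 1))]

theorem isLyapunovPair_bdf_four : ∃ G,
    IsLyapunovPair (fun i => bdfCoeff 4 i) multiplier G multiplierMatrix (1 / 100) := by
  have hw : (fun i : Fin 7 => bdfCoeff 4 i) = ![25/12, -4, 3, -4/3, 1/4, 0, 0] := by
    ext i
    fin_cases i <;> norm_num [bdfCoeff_eq_sum, Finset.sum_Icc_succ_top, Nat.choose]
  rw [hw]
  refine ⟨!![281/160, -14/5, 8/5, -2/5, 0, 0;
      -14/5, 889/160, -41/10, 6/5, 0, 0;
      8/5, -41/10, 669/160, -8/5, 0, 0;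
      -2/5, 6/5, -8/5, 25/32, 0, 0;
      0, 0, 0, 0, 0, 0;
      0, 0, 0, 0, 0, 0],
    by norm_num, fun x => ?_, multiplierMatrix_nonneg, fun x => ?_, multiplierMatrix_coercive⟩
  · simp only [Fin.sum_univ_six, Matrix.of_apply, Matrix.cons_val]
    linarith [sq_nonneg (-64 * x 0 + 192 * x 1 - 256 * x 2 + 125 * x 3),
    sq_nonneg (15616 * x 0 - 32848 * x 1 + 18089 * x 2),
    sq_nonneg (-740672 * x 0 + 704843 * x 1),
    sq_nonneg (x 0)]
  · simp only [multiplier, Fin.sum_univ_six, Fin.sum_univ_seven, Matrix.of_apply,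
      Matrix.cons_val, Fin.reduceCastSucc, Fin.reduceSucc]
    linarith [sq_nonneg (-20 * (x 0 - x 1) + 72 * (x 1 - x 2) - 134 * (x 2 - x 3) + 125 * (x 3 - x 4)),
    sq_nonneg (9835 * (x 0 - x 1) - 16681 * (x 1 - x 2) + 14757 * (x 2 - x 3)),
    sq_nonneg (-26195 * (x 0 - x 1) + 83921 * (x 1 - x 2)),
    sq_nonneg ((x 0 - x 1))]

theorem isLyapunovPair_bdf_five : ∃ G,
    IsLyapunovPair (fun i => bdfCoeff 5 i) multiplier G multiplierMatrix (1 / 100) := by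
  have hw : (fun i : Fin 7 => bdfCoeff 5 i) = ![137/60, -5, 5, -10/3, 5/4, -1/5, 0] := by
    ext i
    fin_cases i <;> norm_num [bdfCoeff_eq_sum, Finset.sum_Icc_succ_top, Nat.choose]
  rw [hw]
  refine ⟨!![1657/800, -18/5, 27/10, -13/10, 3/10, 0;
      -18/5, 6077/800, -34/5, 7/2, -9/10, 0;
      27/10, -34/5, 6217/800, -49/10, 7/5, 0;
      -13/10, 7/2, -49/10, 3297/800, -3/2, 0;
      3/10, -9/10, 7/5, -3/2, 143/200, 0;
      0, 0, 0, 0, 0, 0],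
    by norm_num, fun x => ?_, multiplierMatrix_nonneg, fun x => ?_, multiplierMatrix_coercive⟩
  · simp only [Fin.sum_univ_six, Matrix.of_apply, Matrix.cons_val]
    linarith [sq_nonneg (60 * x 0 - 180 * x 1 + 280 * x 2 - 300 * x 3 + 143 * x 4),
    sq_nonneg (-76720 * x 0 + 184400 * x 1 - 224560 * x 2 + 111471 * x 3),
    sq_nonneg (67916560 * x 0 - 159679040 * x 1 + 95920807 * x 2),
    sq_nonneg (-21618520320 * x 0 + 20875994713 * x 1),
    sq_nonneg (x 0)]
  · simp only [multiplier, Fin.sum_univ_six, Fin.sum_univ_seven, Matrix.of_apply,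
      Matrix.cons_val, Fin.reduceCastSucc, Fin.reduceSucc]
    linarith [sq_nonneg (20 * (x 0 - x 1) - 68 * (x 1 - x 2) + 126 * (x 2 - x 3) - 157 * (x 3 - x 4) + 143 * (x 4 - x 5)),
    sq_nonneg (-2636 * (x 0 - x 1) + 5416 * (x 1 - x 2) - 6082 * (x 2 - x 3) + 5935 * (x 3 - x 4)),
    sq_nonneg (304085 * (x 0 - x 1) - 621779 * (x 1 - x 2) + 815439 * (x 2 - x 3)),
    sq_nonneg (-25525519 * (x 0 - x 1) + 71579221 * (x 1 - x 2)),
    sq_nonneg ((x 0 - x 1))]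

theorem isLyapunovPair_bdf_six : ∃ G,
    IsLyapunovPair (fun i => bdfCoeff 6 i) multiplier G multiplierMatrix (1 / 100) := by
  have hw : (fun i : Fin 7 => bdfCoeff 6 i) = ![49/20, -6, 15/2, -20/3, 15/4, -6/5, 1/6] := by
    ext i
    fin_cases i <;> norm_num [bdfCoeff_eq_sum, Finset.sum_Icc_succ_top, Nat.choose]
  rw [hw]
  refine ⟨!![1817/800, -343/80, 161/40, -229/80, 27/20, -5/16;
      -343/80, 7517/800, -773/80, 55/8, -281/80, 37/40;
      161/40, -773/80, 8987/800, -339/40, 361/80, -107/80;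
      -229/80, 55/8, -339/40, 5747/800, -67/16, 101/80;
      27/20, -281/80, 361/80, -67/16, 299/100, -43/40;
      -5/16, 37/40, -107/80, 101/80, -43/40, 21/40],
    by norm_num, fun x => ?_, multiplierMatrix_nonneg, fun x => ?_, multiplierMatrix_coercive⟩
  · simp only [Fin.sum_univ_six, Matrix.of_apply, Matrix.cons_val]
    linarith [sq_nonneg (-25 * x 0 + 74 * x 1 - 107 * x 2 + 101 * x 3 - 86 * x 4 + 42 * x 5),
    sq_nonneg (5965 * x 0 - 13595 * x 1 + 14900 * x 2 - 13460 * x 3 + 6626 * x 4),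
    sq_nonneg (-1771745 * x 0 + 3612190 * x 1 - 4387285 * x 2 + 2365946 * x 3),
    sq_nonneg (742744845 * x 0 - 2156321690 * x 1 + 1453558507 * x 2),
    sq_nonneg (-787443750685 * x 0 + 784896025684 * x 1),
    sq_nonneg (x 0)]
  · simp only [multiplier, Fin.sum_univ_six, Fin.sum_univ_seven, Matrix.of_apply,
      Matrix.cons_val, Fin.reduceCastSucc, Fin.reduceSucc]
    linarith [sq_nonneg (-20 * (x 0 - x 1) + 83 * (x 1 - x 2) - 153 * (x 2 - x 3) + 171 * (x 3 - x 4) - 132 * (x 4 - x 5) + 126 * (x 5 - x 6)),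
    sq_nonneg (2945 * (x 0 - x 1) - 6788 * (x 1 - x 2) + 7866 * (x 2 - x 3) - 6642 * (x 3 - x 4) + 6648 * (x 4 - x 5)),
    sq_nonneg (-24193 * (x 0 - x 1) + 21238 * (x 1 - x 2) - 18072 * (x 2 - x 3) + 27510 * (x 3 - x 4)),
    sq_nonneg (151931 * (x 0 - x 1) - 11564 * (x 1 - x 2) + 167994 * (x 2 - x 3)),
    sq_nonneg (-59465 * (x 0 - x 1) + 1056446 * (x 1 - x 2)),
    sq_nonneg ((x 0 - x 1))]

theorem exists_isLyapunovPair_bdf {k : ℕ} (hk : 1 ≤ k) (hk6 : k ≤ 6) : ∃ m G P ε,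
    IsLyapunovPair (fun i => bdfCoeff k i) m G P ε := by
  suffices h : ∃ G,
      IsLyapunovPair (fun i => bdfCoeff k i) multiplier G multiplierMatrix (1 / 100) by
    exact ⟨multiplier, h.choose, multiplierMatrix, 1 / 100, h.choose_spec⟩
  interval_cases k
  exacts [isLyapunovPair_bdf_one, isLyapunovPair_bdf_two, isLyapunovPair_bdf_three,
    isLyapunovPair_bdf_four, isLyapunovPair_bdf_five, isLyapunovPair_bdf_six]

/-! ### Geometric decay of the energy -/

namespace IsLyapunovPair

variable {w m : Fin 7 → ℝ} {G P : Matrix (Fin 6) (Fin 6) ℝ} {ε : ℝ}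

/-- Exponential decay of the solutions of the multistep scheme, with constants that do not depend
on the bilinear forms other than through the lower bound `l₀ * b ≤ a`. -/
theorem exists_decay (h : IsLyapunovPair w m G P ε) {l₀ τ₀ : ℝ} (hl₀ : 0 < l₀) (hτ₀ : 0 < τ₀) :
    ∃ C c : ℝ, 0 < C ∧ 0 < c ∧ ∀ {E : Type*} [AddCommGroup E] [Module ℝ E]
      (a b : E →ₗ[ℝ] E →ₗ[ℝ] ℝ) (_ : ∀ x y, a x y = a y x) (_ : ∀ x y, b x y = b y x)
      (_ : ∀ x, 0 ≤ b x x) (_ : ∀ x, l₀ * b x x ≤ a x x) (τ : ℝ) (_ : 0 < τ) (_ : τ ≤ τ₀)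
      (u : ℕ → E) (M : ℕ)
      (_ : ∀ n < M, ∀ φ, ∑ i : Fin 7, w i * b (u (n + 6 - i)) φ + τ * a (u (n + 6)) φ = 0),
      b (u (M + 5)) (u (M + 5)) ≤ C * Real.exp (-(c * (M * τ))) *
        ∑ i : Fin 6, (b (u (5 - i)) (u (5 - i)) + τ * a (u (5 - i)) (u (5 - i))) := by
  set K : ℝ := ∑ i, ∑ j, |G i j| + ∑ i, ∑ j, |P i j| + 1 with hK
  have hG0 : 0 ≤ ∑ i, ∑ j, |G i j| := by positivity
  have hP0 : 0 ≤ ∑ i, ∑ j, |P i j| := by positivity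
  have hKpos : 0 < K := by positivity
  have hε := h.pos
  -- Since `b ≤ a / l₀` and `τ ≤ τ₀`, the energy is at most `K (1/l₀ + τ₀) ∑ a`; this `d` makes `d`
  -- times the energy at most the surplus `ε ∑ a`.
  set d : ℝ := ε / (K * (1 / l₀ + τ₀)) with hd
  have hdpos : 0 < d := by positivity
  refine ⟨K / ε, d / (1 + d * τ₀), by positivity, by positivity, ?_⟩
  intro E _ _ a b ha hb hb0 hab τ hτ hττ₀ u M heq
  have ha0 : ∀ x, 0 ≤ a x x := fun x => (mul_nonneg hl₀.le (hb0 x)).trans (hab x)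
  let win : ℕ → Fin 6 → E := fun n i => u (n + 5 - i)
  let energy : ℕ → ℝ := fun n => tupleForm G b (win n) + τ * tupleForm P a (win n)
  have henergy_le : ∀ n, energy n ≤
      K * ∑ i, (b (win n i) (win n i) + τ * a (win n i) (win n i)) := by
    intro n
    have h1 := tupleForm_le G b hb hb0 (win n)
    have h2 := mul_le_mul_of_nonneg_left (tupleForm_le P a ha ha0 (win n)) hτ.le
    have hB : 0 ≤ ∑ i, b (win n i) (win n i) := Finset.sum_nonneg fun i _ => hb0 _
    have hA : 0 ≤ τ * ∑ i, a (win n i) (win n i) :=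
      mul_nonneg hτ.le (Finset.sum_nonneg fun i _ => ha0 _)
    rw [Finset.sum_add_distrib, ← Finset.mul_sum]
    simp only [energy]
    nlinarith [mul_nonneg hG0 hA, mul_nonneg hP0 hB]
  have hstep : ∀ n < M, energy (n + 1) * (1 + d * τ) ≤ energy n := by
    intro n hn
    have h1 := h.energy_le ha ha0 hb hb0 hτ.le (fun i : Fin 7 => u (n + 6 - i)) (heq n hn)
    have e1 : (fun i : Fin 6 => u (n + 6 - (i.castSucc : Fin 7))) = win (n + 1) := by
      funext i; simp only [win, Fin.val_castSucc]
    have e2 : (fun i : Fin 6 => u (n + 6 - (i.succ : Fin 7))) = win n := by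
      funext i; simp only [win, Fin.val_succ]; congr 1; omega
    simp only [e1, e2] at h1
    have h2 : ∑ i, a (win (n + 1) i) (win (n + 1) i) ≤
        ∑ i : Fin 7, a (u (n + 6 - i)) (u (n + 6 - i)) := by
      rw [Fin.sum_univ_castSucc (n := 6), ← e1]
      exact le_add_of_nonneg_right (ha0 _)
    have h3 : energy (n + 1) ≤
        K * (1 / l₀ + τ₀) * ∑ i, a (win (n + 1) i) (win (n + 1) i) := by
      refine (henergy_le _).trans ?_
      rw [mul_assoc]
      refine mul_le_mul_of_nonneg_left ?_ hKpos.le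
      rw [Finset.mul_sum]
      refine Finset.sum_le_sum fun i _ => ?_
      rw [add_mul]
      refine add_le_add ?_ (mul_le_mul_of_nonneg_right hττ₀ (ha0 _))
      rw [one_div, ← div_eq_inv_mul, le_div_iff₀ hl₀, mul_comm]
      exact hab _
    have h4 : d * energy (n + 1) ≤ ε * ∑ i, a (win (n + 1) i) (win (n + 1) i) := by
      rw [hd, div_mul_eq_mul_div, div_le_iff₀ (by positivity)]
      nlinarith
    have h5 : τ * (d * energy (n + 1)) ≤
        τ * (ε * ∑ i : Fin 7, a (u (n + 6 - i)) (u (n + 6 - i))) :=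
      mul_le_mul_of_nonneg_left (h4.trans (mul_le_mul_of_nonneg_left h2 hε.le)) hτ.le
    simp only [energy] at h5 ⊢
    linarith
  -- From `log (1 + dτ) ≥ dτ / (1 + dτ) ≥ dτ / (1 + dτ₀)`: the rate stays uniform for `τ ≤ τ₀`.
  have hexp : Real.exp (d / (1 + d * τ₀) * τ) ≤ 1 + d * τ := by
    have hpos : 0 < 1 + d * τ := by positivity
    rw [← Real.le_log_iff_exp_le hpos]
    refine le_trans ?_ (Real.one_sub_inv_le_log_of_pos hpos)
    have : 1 - (1 + d * τ)⁻¹ = d / (1 + d * τ) * τ := by field_simp; ring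
    rw [this]
    gcongr
  have hdecay : ∀ n ≤ M, energy n ≤ Real.exp (-(d / (1 + d * τ₀) * (n * τ))) * energy 0 := by
    intro n
    induction n with
    | zero => simp
    | succ n ih =>
      intro hn
      have hpos : 0 ≤ energy (n + 1) := add_nonneg
        ((mul_nonneg hε.le (hb0 _)).trans (h.le_tupleForm hb hb0 _))
        (mul_nonneg hτ.le (h.tupleForm_nonneg ha ha0 _))
      have h1 : energy (n + 1) * Real.exp (d / (1 + d * τ₀) * τ) ≤
          Real.exp (-(d / (1 + d * τ₀) * (n * τ))) * energy 0 :=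
        (mul_le_mul_of_nonneg_left hexp hpos).trans ((hstep n hn).trans (ih (by omega)))
      rw [← le_div_iff₀ (Real.exp_pos _), mul_div_right_comm, ← Real.exp_sub] at h1
      refine h1.trans_eq ?_
      congr 2
      push_cast
      ring
  have hlow : ε * b (u (M + 5)) (u (M + 5)) ≤ energy M :=
    (h.le_tupleForm hb hb0 (win M)).trans
      (le_add_of_nonneg_right (mul_nonneg hτ.le (h.tupleForm_nonneg ha ha0 _)))
  have h0 := henergy_le 0
  simp only [win, zero_add] at h0
  have h1 := hlow.trans ((hdecay M le_rfl).trans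
    (mul_le_mul_of_nonneg_left h0 (Real.exp_pos _).le))
  rw [← le_div_iff₀' hε] at h1
  refine h1.trans_eq ?_
  ring

end IsLyapunovPair

/-! ### Real forms on the Gelfand triple -/

variable {V H : Type*}
  [NormedAddCommGroup V] [InnerProductSpace ℂ V]
  [NormedAddCommGroup H] [InnerProductSpace ℂ H]

/-- The real bilinear form `Re (x, y)` of `H`, pulled back to `V`. -/
noncomputable def innerForm (ι : V →L[ℂ] H) : V →ₗ[ℝ] V →ₗ[ℝ] ℝ :=
  LinearMap.mk₂ ℝ (fun x y => (inner ℂ (ι y) (ι x)).re)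
    (fun x y z => by simp)
    (fun r x y => by
      rw [← Complex.coe_smul, map_smul, inner_smul_right, Complex.re_ofReal_mul, smul_eq_mul])
    (fun x y z => by simp)
    (fun r x y => by
      rw [← Complex.coe_smul, map_smul, inner_smul_left, Complex.conj_ofReal,
        Complex.re_ofReal_mul, smul_eq_mul])

theorem innerForm_apply (ι : V →L[ℂ] H) (x y : V) :
    innerForm ι x y = (inner ℂ (ι y) (ι x)).re := rfl

theorem innerForm_self (ι : V →L[ℂ] H) (x : V) : innerForm ι x x = ‖ι x‖ ^ 2 := by
  rw [innerForm_apply, inner_self_eq_norm_sq_to_K]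
  norm_cast

theorem innerForm_symm (ι : V →L[ℂ] H) (x y : V) : innerForm ι x y = innerForm ι y x := by
  rw [innerForm_apply, innerForm_apply, ← inner_conj_symm, Complex.conj_re]

/-- The real bilinear form `Re ⟨A x, y⟩` on `V`. -/
noncomputable def operatorForm (A : V →L[ℂ] (V →L⋆[ℂ] ℂ)) : V →ₗ[ℝ] V →ₗ[ℝ] ℝ :=
  LinearMap.mk₂ ℝ (fun x y => (A x y).re)
    (fun x y z => by simp)
    (fun r x y => by
      rw [← Complex.coe_smul, map_smul, smul_apply, smul_eq_mul,
        Complex.re_ofReal_mul, smul_eq_mul])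
    (fun x y z => by simp)
    (fun r x y => by
      rw [← Complex.coe_smul, map_smulₛₗ, Complex.conj_ofReal, smul_eq_mul,
        Complex.re_ofReal_mul, smul_eq_mul])

theorem operatorForm_apply (A : V →L[ℂ] (V →L⋆[ℂ] ℂ)) (x y : V) :
    operatorForm A x y = (A x y).re := rfl

theorem operatorForm_symm {A : V →L[ℂ] (V →L⋆[ℂ] ℂ)} {β₀ β₁ : ℝ}
    (hA : IsEllipticSelfAdjoint A β₀ β₁) (x y : V) : operatorForm A x y = operatorForm A y x := by
  rw [operatorForm_apply, operatorForm_apply, hA.selfAdjoint x y, Complex.star_def,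
    Complex.conj_re]

theorem innerForm_le_operatorForm (ι : V →L[ℂ] H) {A : V →L[ℂ] (V →L⋆[ℂ] ℂ)} {β₀ β₁ : ℝ}
    (hβ₀ : 0 < β₀) (hA : IsEllipticSelfAdjoint A β₀ β₁) (x : V) :
    β₀ / (‖ι‖ ^ 2 + 1) * innerForm ι x x ≤ operatorForm A x x := by
  refine le_trans ?_ (hA.lower x)
  have h := pow_le_pow_left₀ (norm_nonneg _) (ι.le_opNorm x) 2
  rw [innerForm_self, div_mul_eq_mul_div, div_le_iff₀ (by positivity), mul_assoc]
  refine mul_le_mul_of_nonneg_left ?_ hβ₀.le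
  nlinarith [sq_nonneg ‖x‖]

/-! ### Uniform stability of the homogeneous scheme -/

/-- `U` solves the homogeneous BDF`k` scheme on `1 ≤ n ≤ N`. -/
def IsHomogeneousSolution (ι : V →L[ℂ] H) (A : V →L[ℂ] (V →L⋆[ℂ] ℂ)) (k N : ℕ) (τ : ℝ)
    (U : ℤ → H) : Prop :=
  ∀ n : ℤ, 1 ≤ n → n ≤ (N : ℤ) →
    ∃ w : V, ι w = U n ∧ toAntidual ι (bdfDiff k τ U n) + A w = 0

/-- The scheme tested with `φ`, in terms of real inner products. -/
theorem tested_equation {ι : V →L[ℂ] H} {A : V →L[ℂ] (V →L⋆[ℂ] ℂ)} {k : ℕ} {τ : ℝ} (hτ : 0 < τ)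
    {U : ℤ → H} {n : ℤ} {w : V} (h : toAntidual ι (bdfDiff k τ U n) + A w = 0) (φ : V) :
    ∑ j ∈ Finset.range (k + 1), bdfCoeff k j * (inner ℂ (ι φ) (U (n - j))).re +
      τ * operatorForm A w φ = 0 := by
  have h1 := congrArg Complex.re (DFunLike.congr_fun h φ)
  simp only [add_apply, toAntidual_apply, bdfDiff, inner_smul_right,
    inner_sum, Complex.add_re, Complex.re_ofReal_mul, Complex.re_sum,
    zero_apply, Complex.zero_re] at h1
  rw [operatorForm_apply]
  field_simp at h1
  linarith

/-- One implicit step, with starting values bounded by `S`. -/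
theorem step_bound {ι : V →L[ℂ] H} {A : V →L[ℂ] (V →L⋆[ℂ] ℂ)} {k : ℕ} (hk : 1 ≤ k) {τ : ℝ}
    (hτ : 0 < τ) (hA : ∀ x, 0 ≤ operatorForm A x x) {U : ℤ → H} {n : ℤ} {w : V} (hw : ι w = U n)
    (h : toAntidual ι (bdfDiff k τ U n) + A w = 0) {S : ℝ}
    (hS : ∀ j : ℕ, 1 ≤ j → j ≤ k → ‖U (n - j)‖ ≤ S) :
    bdfCoeff k 0 * ‖U n‖ ≤ (∑ j ∈ Finset.range (k + 1), |bdfCoeff k j|) * S ∧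
    τ * operatorForm A w w ≤ (∑ j ∈ Finset.range (k + 1), |bdfCoeff k j|) * S * ‖U n‖ := by
  have hS0 : 0 ≤ S := (norm_nonneg _).trans (hS 1 le_rfl hk)
  -- Testing with `U^n` itself makes the implicit terms `ω₀ ‖U^n‖²` and `τ ⟨A w, w⟩` both
  -- nonnegative, so each is bounded by the Cauchy–Schwarz estimate of the history terms.
  have h1 := tested_equation hτ h w
  rw [Finset.sum_range_succ', hw] at h1
  have h2 : (inner ℂ (U n) (U (n - (0 : ℕ)))).re = ‖U n‖ ^ 2 := by
    rw [Nat.cast_zero, sub_zero, inner_self_eq_norm_sq_to_K]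
    norm_cast
  rw [h2] at h1
  have h3 : -∑ j ∈ Finset.range k,
      bdfCoeff k (j + 1) * (inner ℂ (U n) (U (n - (j + 1 : ℕ)))).re ≤
      (∑ j ∈ Finset.range (k + 1), |bdfCoeff k j|) * S * ‖U n‖ := by
    rw [Finset.sum_range_succ', ← Finset.sum_neg_distrib, mul_assoc, add_mul, Finset.sum_mul]
    refine le_add_of_le_of_nonneg (Finset.sum_le_sum fun j hj => ?_) (by positivity)
    refine (neg_le_abs _).trans ?_
    rw [abs_mul]
    refine mul_le_mul_of_nonneg_left ?_ (abs_nonneg _)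
    refine (Complex.abs_re_le_norm _).trans ((norm_inner_le_norm _ _).trans ?_)
    rw [mul_comm]
    exact mul_le_mul_of_nonneg_right
      (hS (j + 1) (by omega) (by have := Finset.mem_range.mp hj; omega)) (norm_nonneg _)
  have hω := bdfCoeff_zero_pos hk
  have h4 := mul_nonneg hτ.le (hA w)
  have h5 : 0 ≤ bdfCoeff k 0 * ‖U n‖ ^ 2 := by positivity
  refine ⟨?_, by linarith⟩
  rcases (norm_nonneg (U n)).eq_or_lt with h0 | h0
  · rw [← h0, mul_zero]
    positivity
  · refine le_of_mul_le_mul_right ?_ h0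
    linarith

/-- Stability over finitely many steps, uniformly in the step size. -/
theorem norm_le_pow_mul {ι : V →L[ℂ] H} {A : V →L[ℂ] (V →L⋆[ℂ] ℂ)} {k N : ℕ} (hk : 1 ≤ k) {τ : ℝ}
    (hτ : 0 < τ) (hA : ∀ x, 0 ≤ operatorForm A x x) {U : ℤ → H}
    (hU : IsHomogeneousSolution ι A k N τ U) {D X : ℝ}
    (hD : D = 1 + (∑ j ∈ Finset.range (k + 1), |bdfCoeff k j|) / bdfCoeff k 0)
    (hX : ∀ j : ℕ, j < k → ‖U (-(j : ℤ))‖ ≤ X) (n : ℕ) (hn : n ≤ N) :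
    ∀ i : ℤ, -(k : ℤ) < i → i ≤ n → ‖U i‖ ≤ D ^ n * X := by
  have hω := bdfCoeff_zero_pos hk
  have hX0 : 0 ≤ X := (norm_nonneg _).trans (hX 0 hk)
  have hW : 0 ≤ (∑ j ∈ Finset.range (k + 1), |bdfCoeff k j|) / bdfCoeff k 0 := by positivity
  have hD1 : 1 ≤ D := by linarith
  induction n with
  | zero =>
    intro i hi hi0
    obtain ⟨j, rfl⟩ : ∃ j : ℕ, i = -(j : ℤ) := ⟨i.natAbs, by omega⟩
    simpa using hX j (by omega)
  | succ n ih =>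
    have ih := ih (by omega)
    intro i hi hin
    have hpow : D ^ n * X ≤ D ^ (n + 1) * X :=
      mul_le_mul_of_nonneg_right (pow_le_pow_right₀ hD1 n.le_succ) hX0
    rcases lt_or_eq_of_le hin with hlt | rfl
    · exact (ih i hi (by push_cast at hlt; omega)).trans hpow
    · obtain ⟨w, hw, heq⟩ := hU (n + 1 : ℕ) (by push_cast; omega) (by exact_mod_cast hn)
      have h := (step_bound hk hτ hA hw heq (S := D ^ n * X)
        fun j hj hjk => ih _ (by push_cast; omega) (by push_cast; omega)).1
      rw [← le_div_iff₀' hω, mul_div_right_comm] at h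
      refine h.trans ?_
      rw [pow_succ', mul_assoc]
      exact mul_le_mul_of_nonneg_right (by linarith) (by positivity)

/-- Uniform exponential stability of the homogeneous BDF`k` scheme for `k ≤ 6`. -/
theorem exists_exponential_stability (ι : V →L[ℂ] H) {k : ℕ} (hk : 1 ≤ k) (hk6 : k ≤ 6)
    {β₀ τ₀ : ℝ} (hβ₀ : 0 < β₀) (hτ₀ : 0 < τ₀) :
    ∃ C c : ℝ, 0 < C ∧ 0 < c ∧ ∀ (A : V →L[ℂ] (V →L⋆[ℂ] ℂ)) (β₁ : ℝ)
      (_ : IsEllipticSelfAdjoint A β₀ β₁) (N : ℕ) (τ : ℝ) (_ : 0 < τ) (_ : τ ≤ τ₀) (U : ℤ → H)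
      (_ : IsHomogeneousSolution ι A k N τ U) (X : ℝ)
      (_ : ∀ j : ℕ, j < k → ‖U (-(j : ℤ))‖ ≤ X) (n : ℤ) (_ : -(k : ℤ) < n) (_ : n ≤ N),
      ‖U n‖ ≤ C * Real.exp (-(c * (n * τ))) * X := by
  obtain ⟨m, G, P, ε, hpair⟩ := exists_isLyapunovPair_bdf hk hk6
  obtain ⟨C, c, hC, hc, hdecay⟩ := hpair.exists_decay
    (l₀ := β₀ / (‖ι‖ ^ 2 + 1)) (by positivity) hτ₀
  set W := ∑ j ∈ Finset.range (k + 1), |bdfCoeff k j| with hW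
  obtain ⟨D, hD⟩ : ∃ D, D = 1 + W / bdfCoeff k 0 := ⟨_, rfl⟩
  have hω := bdfCoeff_zero_pos hk
  have hW0 : 0 ≤ W := by positivity
  have hWω : 0 ≤ W / bdfCoeff k 0 := by positivity
  have hD1 : 1 ≤ D := by linarith
  -- `D ^ 6` pays for the first six steps and `exp (3 c τ₀)` for starting the decay six steps late
  -- at rate `c / 2`; the rate is halved because `exists_decay` bounds squared norms.
  refine ⟨(1 + √(C * (6 * (1 + W)))) * D ^ 6 * Real.exp (3 * c * τ₀), c / 2, by positivity,
    by positivity, ?_⟩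
  intro A β₁ hA N τ hτ hττ₀ U hU X hX n hkn hnN
  have hX0 : 0 ≤ X := (norm_nonneg _).trans (hX 0 hk)
  have hcoer := innerForm_le_operatorForm ι hβ₀ hA
  have hb0 : ∀ x, 0 ≤ innerForm ι x x := fun x => by rw [innerForm_self]; positivity
  have hA0 : ∀ x, 0 ≤ operatorForm A x x := fun x =>
    (mul_nonneg (by positivity) (hb0 x)).trans (hcoer x)
  have hsqrt := Real.sqrt_nonneg (C * (6 * (1 + W)))
  have hshort : ∀ i : ℤ, -(k : ℤ) < i → i ≤ N → i ≤ 6 → ‖U i‖ ≤ D ^ 6 * X := by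
    intro i hi hiN hi6
    refine (norm_le_pow_mul hk hτ hA0 hU hD hX i.toNat (by omega) i hi (by omega)).trans ?_
    exact mul_le_mul_of_nonneg_right (pow_le_pow_right₀ hD1 (by omega)) hX0
  rcases le_or_gt n 6 with hn6 | hn6
  · refine (hshort n hkn hnN hn6).trans (mul_le_mul_of_nonneg_right ?_ hX0)
    have h1 : 1 ≤ Real.exp (3 * c * τ₀) * Real.exp (-(c / 2 * (n * τ))) := by
      rw [← Real.exp_add]
      refine Real.one_le_exp ?_
      have : (n : ℝ) * τ ≤ 6 * τ₀ := by
        have h6 : (n : ℝ) ≤ 6 := by exact_mod_cast hn6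
        nlinarith
      nlinarith
    calc D ^ 6 = 1 * D ^ 6 * 1 := by ring
      _ ≤ (1 + √(C * (6 * (1 + W)))) * D ^ 6 *
          (Real.exp (3 * c * τ₀) * Real.exp (-(c / 2 * (n * τ)))) := by
        gcongr
        linarith
      _ = _ := by ring
  obtain ⟨M, rfl⟩ : ∃ M : ℕ, n = M + 6 := ⟨(n - 6).toNat, by omega⟩
  -- The shift `u i = U^{i+1}` makes the first window `U^1, …, U^6`, all in `V`; beyond `N` the
  -- sequence is padded by zero and never used.
  have hsol : ∀ i : ℕ, ∃ w : V, i + 1 ≤ N → ι w = U (i + 1) ∧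
      toAntidual ι (bdfDiff k τ U (i + 1)) + A w = 0 := by
    intro i
    by_cases hi : i + 1 ≤ N
    · obtain ⟨w, hw⟩ := hU (i + 1) (by omega) (by omega)
      exact ⟨w, fun _ => hw⟩
    · exact ⟨0, fun h => absurd h hi⟩
  choose u hu using hsol
  have hmain := hdecay (operatorForm A) (innerForm ι) (operatorForm_symm hA) (innerForm_symm ι)
    hb0 hcoer τ hτ hττ₀ u M (by
      intro q hq φ
      have h1 := tested_equation hτ (hu (q + 6) (by omega)).2 φ
      have h2 : ∑ i : Fin 7, bdfCoeff k i * innerForm ι (u (q + 6 - i)) φ =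
          ∑ j ∈ Finset.range (k + 1),
            bdfCoeff k j * (inner ℂ (ι φ) (U (((q + 6 : ℕ) : ℤ) + 1 - j))).re := by
        rw [Fin.sum_univ_eq_sum_range
          (fun j => bdfCoeff k j * innerForm ι (u (q + 6 - j)) φ) 7]
        rw [← Finset.sum_subset (Finset.range_mono (show k + 1 ≤ 7 by omega))]
        · refine Finset.sum_congr rfl fun j hj => ?_
          have hj7 := Finset.mem_range.mp hj
          rw [innerForm_apply, (hu (q + 6 - j) (by omega)).1]
          congr 4
          omega
        · intro j _ hj
          rw [bdfCoeff_eq_zero (by simpa using hj), zero_mul]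
      rw [h2]
      exact h1)
  have hinit : ∀ i : Fin 6, innerForm ι (u (5 - i)) (u (5 - i)) +
      τ * operatorForm A (u (5 - i)) (u (5 - i)) ≤ (1 + W) * (D ^ 6 * X) ^ 2 := by
    intro i
    obtain ⟨hw, heq⟩ := hu (5 - i) (by omega)
    have hn := hshort (((5 - i : ℕ) : ℤ) + 1) (by omega) (by omega) (by omega)
    have hA' := (step_bound hk hτ hA0 hw heq (S := D ^ 6 * X)
      fun j hj hjk => hshort _ (by omega) (by omega) (by omega)).2
    rw [innerForm_self, hw]
    have h1 := pow_le_pow_left₀ (norm_nonneg _) hn 2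
    have h2 := mul_le_mul_of_nonneg_left hn (show 0 ≤ W * (D ^ 6 * X) by positivity)
    linarith
  have hfin := hmain.trans (mul_le_mul_of_nonneg_left
    (Finset.sum_le_sum fun i _ => hinit i) (by positivity))
  rw [innerForm_self, (hu (M + 5) (by omega)).1, Finset.sum_const, Finset.card_univ,
    Fintype.card_fin, nsmul_eq_mul] at hfin
  have hidx : (((M + 5 : ℕ) : ℤ) + 1) = (M : ℤ) + 6 := by push_cast; ring
  rw [hidx] at hfin
  have hexp : Real.exp (-(c * (M * τ))) = Real.exp (-(c / 2 * (M * τ))) ^ 2 := by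
    rw [← Real.exp_nat_mul]
    congr 1
    push_cast
    ring
  have hsq : ‖U (M + 6)‖ ≤
      √(C * (6 * (1 + W))) * Real.exp (-(c / 2 * (M * τ))) * (D ^ 6 * X) := by
    refine le_of_sq_le_sq ?_ (by positivity)
    refine hfin.trans_eq ?_
    rw [mul_pow _ (D ^ 6 * X), mul_pow √_, Real.sq_sqrt (by positivity), hexp]
    push_cast
    ring
  refine hsq.trans ?_
  have hshift : Real.exp (-(c / 2 * (M * τ))) ≤
      Real.exp (3 * c * τ₀) * Real.exp (-(c / 2 * (((M + 6 : ℤ) : ℝ) * τ))) := by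
    rw [← Real.exp_add]
    refine Real.exp_le_exp.mpr ?_
    push_cast
    nlinarith
  calc √(C * (6 * (1 + W))) * Real.exp (-(c / 2 * (M * τ))) * (D ^ 6 * X)
      ≤ (1 + √(C * (6 * (1 + W)))) *
        (Real.exp (3 * c * τ₀) * Real.exp (-(c / 2 * (((M + 6 : ℤ) : ℝ) * τ)))) *
        (D ^ 6 * X) := by
        gcongr
        linarith
    _ = _ := by ring

end ParallelBDF

/-! ### Contraction of the iteration -/

theorem lemma2p5
    {V H : Type*}
    [NormedAddCommGroup V] [InnerProductSpace ℂ V] [CompleteSpace V]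
    [NormedAddCommGroup H] [InnerProductSpace ℂ H] [CompleteSpace H]
    (ι : V →L[ℂ] H) (hι : ParallelBDF.IsGelfandEmbedding ι)
    (k : ℕ) (hk : 1 ≤ k) (hk6 : k ≤ 6)
    (β₀ : ℝ) (hβ₀ : 0 < β₀) (τ₀ : ℝ) (hτ₀ : 0 < τ₀) :
    ∃ c c₁ : ℝ, 0 < c ∧ 0 < c₁ ∧
      ∀ (T : ℝ), 0 < T →
        (∃ κ : ℝ, 0 < κ ∧ c * κ * Real.exp (-c₁ * T) < 1 / 2) ∧
        ∀ κ : ℝ, 0 < κ → c * κ * Real.exp (-c₁ * T) < 1 / 2 →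
          ParallelBDF.gammaFactor c c₁ T κ ∈ Set.Ioo (0 : ℝ) 1 ∧
          ∀ (β₁ : ℝ), β₀ < β₁ →
          ∀ (A : V →L[ℂ] (V →L⋆[ℂ] ℂ)), ParallelBDF.IsEllipticSelfAdjoint A β₀ β₁ →
          ∀ (N : ℕ), 1 ≤ N → T / (N : ℝ) ≤ τ₀ →
          ∀ (U : ℕ → ℤ → H) (m : ℕ), 1 ≤ m →
            ParallelBDF.IsIterationStep ι A k N (T / (N : ℝ)) κ 0 0 (U (m - 1)) (U m) →
            ∑ j ∈ Finset.range k, ‖U m ((N : ℤ) - j)‖ ≤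
              ParallelBDF.gammaFactor c c₁ T κ *
                ∑ j ∈ Finset.range k, ‖U (m - 1) ((N : ℤ) - j)‖ := by
  obtain ⟨C, c₁, hC, hc₁, hstab⟩ :=
    ParallelBDF.exists_exponential_stability ι hk hk6 hβ₀ hτ₀
  have hkpos : (0 : ℝ) < k := by exact_mod_cast hk
  -- The factor `k` counts the final values, and `exp (c₁ k τ₀)` compensates for `U^{N-j}` sitting
  -- up to `k - 1` steps before `T`.
  refine ⟨k * C * Real.exp (c₁ * (k * τ₀)), c₁, by positivity, hc₁, fun T hT => ?_⟩
  set c := k * C * Real.exp (c₁ * (k * τ₀)) with hc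
  have hcpos : 0 < c := by positivity
  have hepos := Real.exp_pos (-c₁ * T)
  -- This `κ` makes `c κ e^{-c₁T}` equal to `1/4`.
  refine ⟨⟨1 / (4 * (c * Real.exp (-c₁ * T))), by positivity, ?_⟩, fun κ hκ hsmall => ?_⟩
  · have : c * (1 / (4 * (c * Real.exp (-c₁ * T)))) * Real.exp (-c₁ * T) = 1 / 4 := by
      field_simp
    rw [this]
    norm_num
  have hq : 0 < c * κ * Real.exp (-c₁ * T) := by positivity
  have hq1 : 0 < 1 - c * κ * Real.exp (-c₁ * T) := by linarith
  refine ⟨⟨div_pos hq hq1, (div_lt_one hq1).mpr (by linarith)⟩, ?_⟩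
  intro β₁ _ A hA N hN hτ U m _ hstep
  have hNpos : (0 : ℝ) < N := by exact_mod_cast hN
  have hτpos : 0 < T / N := by positivity
  set X := ∑ j ∈ Finset.range k, ‖U m (-(j : ℤ))‖ with hX
  have hX0 : 0 ≤ X := by positivity
  -- If `N < k`, some `N - j` are nonpositive; the stability bound covers all indices above `-k`.
  have hend : ∑ j ∈ Finset.range k, ‖U m ((N : ℤ) - j)‖ ≤ c * Real.exp (-c₁ * T) * X := by
    have hterm : ∀ j ∈ Finset.range k, ‖U m ((N : ℤ) - j)‖ ≤
        C * (Real.exp (c₁ * (k * τ₀)) * Real.exp (-c₁ * T)) * X := by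
      intro j hj
      have hjk := Finset.mem_range.mp hj
      refine (hstab A β₁ hA N (T / N) hτpos hτ (U m) hstep.equation X
        (fun i hi => Finset.single_le_sum (f := fun j : ℕ => ‖U m (-(j : ℤ))‖)
          (fun _ _ => norm_nonneg _) (Finset.mem_range.mpr hi)) (N - j) (by omega)
        (by omega)).trans ?_
      rw [← Real.exp_add]
      gcongr
      have h1 : (((N : ℤ) - (j : ℤ) : ℤ) : ℝ) * (T / N) = T - j * (T / N) := by
        push_cast
        field_simp
      have h2 : (j : ℝ) * (T / N) ≤ k * τ₀ := by
        gcongr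
      rw [h1]
      nlinarith
    refine (Finset.sum_le_sum hterm).trans_eq ?_
    rw [Finset.sum_const, Finset.card_range, nsmul_eq_mul, hc]
    ring
  have hstart : X ≤ κ * (∑ j ∈ Finset.range k, ‖U m ((N : ℤ) - j)‖ +
      ∑ j ∈ Finset.range k, ‖U (m - 1) ((N : ℤ) - j)‖) := by
    rw [← Finset.sum_add_distrib, Finset.mul_sum]
    refine Finset.sum_le_sum fun j hj => ?_
    rw [hstep.start j (Finset.mem_range.mp hj), zero_add, norm_smul, Complex.norm_real,
      Real.norm_of_nonneg hκ.le]
    exact mul_le_mul_of_nonneg_left (norm_sub_le _ _) hκ.le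
  -- With the denominator cleared, the claim is `(1 - q) E ≤ q E'`, which follows by inserting
  -- `hstart` into `hend`.
  rw [ParallelBDF.gammaFactor, div_mul_eq_mul_div, le_div_iff₀ hq1]
  have := hend.trans (mul_le_mul_of_nonneg_left hstart (by positivity))
  linarith
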